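/- An instance of MEFE-Matching consists of $n$ courses $X$ and $m$ teaching assistants (TAs) $T$; valuations $v_x : T \to \mathbb{Z}_{\ge 0}$ for each course $x$; utilities $u_t : X \to \mathbb{Z}_{\ge 0}$ and grades $g_t : X \to \mathbb{Q}_{\ge 0}$ for each TA $t$, where $v_x(t) = 0$ if and only if $u_t(x) = 0$; capacities $c_x \ge 1$; and a threshold $k \in \mathbb{Q}_{\ge 0}$. A matching $\mu : T \to X \cup \{\emptyset\}$ is feasible if $|\mu^{-1}(x)| = c_x$ for every course $x$ and $u_t(\mu(t)) \neq 0$ for every assigned TA $t$. It is merit-based envy-free if there are no TAs $t, t'$ with $\mu(t') \in X$, $g_t(\mu(t')) \ge g_{t'}(\mu(t'))$ and $u_t(\mu(t')) > u_t(\mu(t))$, where $u_t(\emptyset) = 0$. Put $\mathsf{AvgUtil}_\mu(x) = \frac{1}{c_x} \sum_{t \in \mu^{-1}(x)} v_x(t)$. The instance is a yes-instance if it has a feasible merit-based envy-free matching $\mu$ with $\mathsf{AvgUtil}_\mu(x) \ge k$ for every course $x$. Let $\mathsf{cap} = \max_x c_x$ and $\mathsf{max_{val}} = \max_{x,t} v_x(t)$.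 Theorem. There is an algorithm which takes as input an instance and a number $0 \le \varepsilon < 1$ and which has the following properties on all instances in which the capacities are bounded by a constant $C$, no two TAs have the same grade in a course, and no TA has the same utility for two courses that the TA values positively. The algorithm always halts. Given a yes-instance, it outputs a feasible merit-based envy-free matching $\mu$ with $\mathsf{AvgUtil}_\mu(x) \ge (1-\varepsilon) k$ for every course $x$. If $\varepsilon > 0$, then, with $\varepsilon' = \frac{1}{1-\varepsilon} - 1$, it runs in time $$\mathcal{O}\Big(\mathsf{cap}^{\frac{n \log \mathsf{max_{val}}}{\log(1+\varepsilon')}}\,(n+m)^{\mathcal{O}(1)}\Big),$$ where each addition, subtraction, comparison and memory access counts as one step, the exponent $\mathcal{O}(1)$ is an absolute constant, and the factor hidden in the outer $\mathcal{O}$ depends only on $C$. -/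

import Mathlib

/-! ## Instances, matchings and fairness -/

/-- An instance with courses `Fin n` and teaching assistants (TAs) `Fin m`. -/
structure MEFE.Instance (n m : ℕ) where
  /-- `val x t`: the utility of course `x` for the TA `t`. -/
  val : Fin n → Fin m → ℕ
  /-- `util t x`: the utility of the TA `t` for the course `x`. -/
  util : Fin m → Fin n → ℕ
  /-- `grade t x`: the grade of the TA `t` in the course `x`. -/
  grade : Fin m → Fin n → ℚ≥0
  /-- `cap x`: the number of TAs that the course `x` requires. -/
  cap : Fin n → ℕ
  /-- The satisfaction threshold. -/
  k : ℚ≥0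
  /-- A course values a TA at zero exactly when the TA values the course at zero. -/
  val_eq_zero_iff : ∀ x t, val x t = 0 ↔ util t x = 0
  /-- Every course requires at least one TA. -/
  cap_pos : ∀ x, 0 < cap x

namespace MEFE

/-- A matching assigns to each TA a course or nothing. -/
abbrev Matching (n m : ℕ) : Type := Fin m → Option (Fin n)

namespace Instance

variable {n m : ℕ}

/-- The TAs assigned to the course `x`. -/
def assigned (μ : Matching n m) (x : Fin n) : Finset (Fin m) :=
  Finset.univ.filter fun t => μ t = some x

/-- Every course gets exactly the required number of TAs, and no TA is assigned to a course that
the TA values at zero. -/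
def Feasible (I : Instance n m) (μ : Matching n m) : Prop :=
  (∀ x, (assigned μ x).card = I.cap x) ∧ ∀ t x, μ t = some x → I.util t x ≠ 0

/-- Average utility of the course `x` under `μ`. -/
noncomputable def avgUtil (I : Instance n m) (μ : Matching n m) (x : Fin n) : ℝ :=
  (∑ t ∈ assigned μ x, (I.val x t : ℝ)) / (I.cap x : ℝ)

/-- The utility of the TA `t` for an assignment; being unassigned has utility zero. -/
def utilOf (I : Instance n m) (t : Fin m) : Option (Fin n) → ℕ
  | none => 0
  | some x => I.util t x

/-- `t` envies `t'` on merit basis: `t'` is assigned to a course in which the grade of `t` is at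
least that of `t'`, and which `t` values more than the own assignment. -/
def Envies (I : Instance n m) (μ : Matching n m) (t t' : Fin m) : Prop :=
  ∃ x, μ t' = some x ∧ I.grade t' x ≤ I.grade t x ∧ I.utilOf t (μ t) < I.util t x

/-- Merit-based envy-freeness. -/
def EnvyFree (I : Instance n m) (μ : Matching n m) : Prop :=
  ∀ t t', ¬ I.Envies μ t t'

/-- Feasible, merit-based envy-free, and every course has average utility at least `θ`. -/
def FairAt (I : Instance n m) (θ : ℝ) (μ : Matching n m) : Prop :=
  I.Feasible μ ∧ I.EnvyFree μ ∧ ∀ x, θ ≤ I.avgUtil μ x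

/-- A yes-instance: there is a fair matching for the threshold `k`. -/
def IsYes (I : Instance n m) : Prop :=
  ∃ μ, I.FairAt (I.k : ℝ) μ

/-- No two TAs have the same grade in a course. -/
def DistinctGrades (I : Instance n m) : Prop :=
  ∀ x, Function.Injective fun t => I.grade t x

/-- No TA gives the same utility to two positively valued courses. -/
def DistinctUtils (I : Instance n m) : Prop :=
  ∀ t, Set.InjOn (I.util t) {x | 0 < I.util t x}

/-- The maximum capacity of a course. -/
def maxCap (I : Instance n m) : ℕ := Finset.univ.sup I.cap

/-- The maximum valuation of a course for a TA. -/
def maxVal (I : Instance n m) : ℕ :=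
  Finset.univ.sup fun x => Finset.univ.sup fun t => I.val x t

end Instance

/-! ## The machine model

A program is a finite piece of text of an imperative language over a random access memory. There
are two kinds of memory cells: cells holding natural numbers (used also as addresses) and cells
holding numerical data. A cell is addressed by an array name, fixed in the program text, and two
computed natural numbers. The operations are addition, subtraction and comparison, at unit cost.
There is no multiplication and no rounding, the only constants are natural numbers, and data never
turn into addresses, so on rational data all computed data are rational and each operation
lengthens the numbers (over a common denominator of the input) by at most one bit. -/

/-- Contents of the memory: array name, then two indices. -/
structure Store where
  nat : ℕ → ℕ → ℕ → ℕ
  dat : ℕ → ℕ → ℕ → ℝ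

/-- Overwrite a cell holding a natural number. -/
def Store.setNat (s : Store) (a i j x : ℕ) : Store :=
  { s with nat := fun a' i' j' => if a' = a ∧ i' = i ∧ j' = j then x else s.nat a' i' j' }

/-- Overwrite a cell holding data. -/
noncomputable def Store.setDat (s : Store) (a i j : ℕ) (x : ℝ) : Store :=
  { s with dat := fun a' i' j' => if a' = a ∧ i' = i ∧ j' = j then x else s.dat a' i' j' }

/-- Expressions for natural numbers. -/
inductive NExpr : Type
  | const (x : ℕ)
  | read (a : ℕ) (i j : NExpr)
  | add (e f : NExpr)
  | sub (e f : NExpr)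

/-- Value of an expression; subtraction of natural numbers is truncated. -/
def NExpr.eval (s : Store) : NExpr → ℕ
  | const x => x
  | read a i j => s.nat a (i.eval s) (j.eval s)
  | add e f => e.eval s + f.eval s
  | sub e f => e.eval s - f.eval s

/-- Number of steps needed to evaluate an expression. -/
def NExpr.cost : NExpr → ℕ
  | const _ => 1
  | read _ i j => 1 + i.cost + j.cost
  | add e f => 1 + e.cost + f.cost
  | sub e f => 1 + e.cost + f.cost

/-- Expressions for data. -/
inductive DExpr : Type
  | ofNat (e : NExpr)
  | read (a : ℕ) (i j : NExpr)
  | add (e f : DExpr)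
  | sub (e f : DExpr)

/-- Value of a data expression. -/
noncomputable def DExpr.eval (s : Store) : DExpr → ℝ
  | ofNat e => (e.eval s : ℝ)
  | read a i j => s.dat a (i.eval s) (j.eval s)
  | add e f => e.eval s + f.eval s
  | sub e f => e.eval s - f.eval s

/-- Number of steps needed to evaluate a data expression. -/
def DExpr.cost : DExpr → ℕ
  | ofNat e => 1 + e.cost
  | read _ i j => 1 + i.cost + j.cost
  | add e f => 1 + e.cost + f.cost
  | sub e f => 1 + e.cost + f.cost

/-- Tests. -/
inductive Test : Type
  | leNat (e f : NExpr)
  | leDat (e f : DExpr)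
  | neg (b : Test)
  | conj (b c : Test)

/-- Truth of a test. -/
def Test.Holds (s : Store) : Test → Prop
  | leNat e f => e.eval s ≤ f.eval s
  | leDat e f => e.eval s ≤ f.eval s
  | neg b => ¬ b.Holds s
  | conj b c => b.Holds s ∧ c.Holds s

/-- Number of steps needed to evaluate a test. -/
def Test.cost : Test → ℕ
  | leNat e f => 1 + e.cost + f.cost
  | leDat e f => 1 + e.cost + f.cost
  | neg b => 1 + b.cost
  | conj b c => 1 + b.cost + c.cost

/-- Programs. -/
inductive Prog : Type
  | nop
  | setNat (a : ℕ) (i j e : NExpr)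
  | setDat (a : ℕ) (i j : NExpr) (e : DExpr)
  | seq (p q : Prog)
  | branch (b : Test) (p q : Prog)
  | loop (b : Test) (p : Prog)

/-- `Runs p s N s'`: the program `p`, started in the memory `s`, halts after exactly `N` steps with
the memory `s'`. (`branch b p q` runs `p` or `q` according to `b`; `loop b p` repeats `p` as long as
`b` holds.) -/
inductive Runs : Prog → Store → ℕ → Store → Prop
  | nop (s : Store) : Runs Prog.nop s 1 s
  | setNat (a : ℕ) (i j e : NExpr) (s : Store) :
      Runs (Prog.setNat a i j e) s (1 + i.cost + j.cost + e.cost)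
        (s.setNat a (i.eval s) (j.eval s) (e.eval s))
  | setDat (a : ℕ) (i j : NExpr) (e : DExpr) (s : Store) :
      Runs (Prog.setDat a i j e) s (1 + i.cost + j.cost + e.cost)
        (s.setDat a (i.eval s) (j.eval s) (e.eval s))
  | seq {p q : Prog} {s s₁ s₂ : Store} {N₁ N₂ : ℕ} :
      Runs p s N₁ s₁ → Runs q s₁ N₂ s₂ → Runs (Prog.seq p q) s (N₁ + N₂) s₂
  | branchTrue {b : Test} {p q : Prog} {s s₁ : Store} {N : ℕ} :
      b.Holds s → Runs p s N s₁ → Runs (Prog.branch b p q) s (1 + b.cost + N) s₁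
  | branchFalse {b : Test} {p q : Prog} {s s₁ : Store} {N : ℕ} :
      ¬ b.Holds s → Runs q s N s₁ → Runs (Prog.branch b p q) s (1 + b.cost + N) s₁
  | loopTrue {b : Test} {p : Prog} {s s₁ s₂ : Store} {N₁ N₂ : ℕ} :
      b.Holds s → Runs p s N₁ s₁ → Runs (Prog.loop b p) s₁ N₂ s₂ →
        Runs (Prog.loop b p) s (1 + b.cost + N₁ + N₂) s₂
  | loopFalse {b : Test} {p : Prog} {s : Store} :
      ¬ b.Holds s → Runs (Prog.loop b p) s (1 + b.cost) s

/-- The machine is deterministic: the number of steps and the final memory are determined by the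
program and the initial memory. -/
theorem Runs.unique {p : Prog} {s s₁ s₂ : Store} {N₁ N₂ : ℕ}
    (h₁ : Runs p s N₁ s₁) (h₂ : Runs p s N₂ s₂) : N₁ = N₂ ∧ s₁ = s₂ := by
  induction h₁ generalizing N₂ s₂ with
  | nop => cases h₂; exact ⟨rfl, rfl⟩
  | setNat => cases h₂; exact ⟨rfl, rfl⟩
  | setDat => cases h₂; exact ⟨rfl, rfl⟩
  | seq _ _ ih₁ ih₂ =>
    cases h₂ with
    | seq k₁ k₂ =>
      obtain ⟨rfl, rfl⟩ := ih₁ k₁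
      obtain ⟨rfl, rfl⟩ := ih₂ k₂
      exact ⟨rfl, rfl⟩
  | branchTrue hb _ ih =>
    cases h₂ with
    | branchTrue _ k => obtain ⟨rfl, rfl⟩ := ih k; exact ⟨rfl, rfl⟩
    | branchFalse hb' _ => exact absurd hb hb'
  | branchFalse hb _ ih =>
    cases h₂ with
    | branchTrue hb' _ => exact absurd hb' hb
    | branchFalse _ k => obtain ⟨rfl, rfl⟩ := ih k; exact ⟨rfl, rfl⟩
  | loopTrue hb _ _ ih₁ ih₂ =>
    cases h₂ with
    | loopTrue _ k₁ k₂ =>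
      obtain ⟨rfl, rfl⟩ := ih₁ k₁
      obtain ⟨rfl, rfl⟩ := ih₂ k₂
      exact ⟨rfl, rfl⟩
    | loopFalse hb' => exact absurd hb hb'
  | loopFalse hb =>
    cases h₂ with
    | loopTrue hb' _ _ => exact absurd hb' hb
    | loopFalse _ => exact ⟨rfl, rfl⟩

/-! ## Input and output conventions -/

/-- The initial memory for the instance `I` and the accuracy `ε`. Natural number arrays:
`0` holds `n` and `m` in its cells `(0, 0)` and `(0, 1)`, and `1` holds the capacity of course `x`
in its cell `(x, 0)`. Data arrays: `0` holds the valuations of the courses, `1` the utilities of the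
TAs, `2` the grades, and `3` holds `k` and `ε` in its cells `(0, 0)` and `(0, 1)`. All other cells
hold `0`. -/
noncomputable def encode {n m : ℕ} (I : Instance n m) (ε : ℝ) : Store where
  nat := fun a i j =>
    if a = 0 ∧ i = 0 ∧ j = 0 then n
    else if a = 0 ∧ i = 0 ∧ j = 1 then m
    else if a = 1 ∧ j = 0 then (if h : i < n then I.cap ⟨i, h⟩ else 0)
    else 0
  dat := fun a i j =>
    if a = 0 then (if h : i < n ∧ j < m then (I.val ⟨i, h.1⟩ ⟨j, h.2⟩ : ℝ) else 0)
    else if a = 1 then (if h : i < m ∧ j < n then (I.util ⟨i, h.1⟩ ⟨j, h.2⟩ : ℝ) else 0)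
    else if a = 2 then (if h : i < m ∧ j < n then (I.grade ⟨i, h.1⟩ ⟨j, h.2⟩ : ℝ) else 0)
    else if a = 3 ∧ i = 0 ∧ j = 0 then (I.k : ℝ)
    else if a = 3 ∧ i = 0 ∧ j = 1 then ε
    else 0

/-- The matching written in the memory: the cell `(t, 0)` of the natural number array `2` holds
`x + 1` if the TA `t` is assigned to the course `x`; any value outside `1, …, n` means that `t` is
unassigned. -/
def decode (n m : ℕ) (s : Store) : Matching n m := fun t =>
  if h : 0 < s.nat 2 t 0 ∧ s.nat 2 t 0 ≤ n then
    some ⟨s.nat 2 t 0 - 1, lt_of_lt_of_le (Nat.sub_lt h.1 Nat.one_pos) h.2⟩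
  else none

end MEFE

/-! ## Deferred acceptance with rejection of unsatisfactory sets

All courses have to be filled, so that fair matchings are stable matchings. The TAs choose their
best available courses, and a course rejects its worst TAs as long as it has too many of them, or
has the right number but too small an average valuation. No pair of a fair matching is ever
rejected, so that after polynomially many rounds the choices form a fair matching for the threshold
`k` itself, if there is one. -/

namespace MEFE

namespace Instance

variable {n m : ℕ}

/-! The average constraint can be built into deferred acceptance because every course must be filled
exactly. Each TA picks the best course whose grade threshold still admits the TA. A course `x`
rejects when its set `S` of applicants has at least `cap x` members but is too large or has total
valuation below `k * |S|`; the threshold then rises just enough to exclude the members of `S` with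
the lowest grade.

No pair of a fair matching `μ` is lost (`FairAt.lt_of_rejects`). Suppose that `μ` gives `x` a TA
`t'` with grade at most the minimum over `S`. Since `S` is not the set that `μ` gives to `x` and is
at least as large, some `t` in `S` is not assigned to `x` by `μ`. All pairs of `μ` were alive so far
and `x` is the best alive course of `t`, so `t` strictly prefers `x` to `μ t` and envies `t'`.

Every round with a rejection kills an alive pair (`aliveCount_lt`), so `m * n` rounds suffice. If a
fair matching exists, counting assigned TAs shows that the final choices fill all courses exactly;
the absence of rejections then gives average at least `k`, and optimality of the choices excludes
envy (`Settled.fairAt`).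

The threshold `k` is thus met exactly in polynomial time. The accuracy `ε` only weakens the
guarantee, and the exponential factor of the bound is at least one. -/

/-- The pair of the TA `t` and the course `x` is acceptable and not excluded by the threshold
`θ x`. The thresholds are grades shifted by one, so that `0` excludes nobody. -/
def Alive (I : Instance n m) (θ : Fin n → ℝ) (t : Fin m) (x : Fin n) : Prop :=
  I.util t x ≠ 0 ∧ θ x < (I.grade t x : ℝ) + 1

/-- `o` is a best alive choice of `t` among the first `j` courses and nothing. -/
def IsBest (I : Instance n m) (θ : Fin n → ℝ) (t : Fin m) (j : ℕ) (o : Option (Fin n)) : Prop :=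
  (∀ x, o = some x → I.Alive θ t x) ∧
    ∀ y : Fin n, y.val < j → I.Alive θ t y → I.util t y ≤ I.utilOf t o

/-- Every TA gets a best alive course. -/
def IsChoice (I : Instance n m) (θ : Fin n → ℝ) (f : Matching n m) : Prop :=
  ∀ t, I.IsBest θ t n (f t)

/-- The course `x` is chosen by enough TAs, but the set of these TAs is too large or has too small
an average valuation. -/
def Rejects (I : Instance n m) (f : Matching n m) (x : Fin n) : Prop :=
  I.cap x ≤ (assigned f x).card ∧ ¬ ((assigned f x).card ≤ I.cap x ∧
    0 ≤ ∑ t ∈ assigned f x, ((I.val x t : ℝ) - (I.k : ℝ)))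

/-- `b` is the threshold of the course `x` after rejections, if `a` is the threshold before. -/
def IsRaised (I : Instance n m) (f : Matching n m) (x : Fin n) (a b : ℝ) : Prop :=
  (I.Rejects f x → IsLeast ((fun t => (I.grade t x : ℝ) + 1) '' (assigned f x : Set (Fin m))) b) ∧
    (¬ I.Rejects f x → b = a)

/-- All pairs of fair matchings are alive. -/
def KeepsFair (I : Instance n m) (θ : Fin n → ℝ) : Prop :=
  ∀ μ, I.FairAt (I.k : ℝ) μ → ∀ t x, μ t = some x → I.Alive θ t x

/-- No course rejects a TA. -/
def Settled (I : Instance n m) (θ : Fin n → ℝ) : Prop :=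
  ∀ f, I.IsChoice θ f → ∀ x, ¬ I.Rejects f x

open Classical in
/-- Number of alive pairs. -/
noncomputable def aliveCount (I : Instance n m) (θ : Fin n → ℝ) : ℕ :=
  (Finset.univ.filter fun p : Fin m × Fin n => I.Alive θ p.1 p.2).card

/-- The thresholds after `r` rounds of rejections. -/
def Reached (I : Instance n m) (r : ℕ) (θ : Fin n → ℝ) : Prop :=
  I.KeepsFair θ ∧ (I.Settled θ ∨ I.aliveCount θ + r ≤ m * n)

variable {I : Instance n m} {θ θ' : Fin n → ℝ} {f μ : Matching n m}

/-! ### Choices of the TAs and their uniqueness. -/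

theorem mem_assigned {t : Fin m} {x : Fin n} : t ∈ assigned f x ↔ f t = some x := by
  simp [assigned]

theorem IsChoice.alive (hf : I.IsChoice θ f) {t : Fin m} {x : Fin n} (h : f t = some x) :
    I.Alive θ t x := (hf t).1 x h

theorem IsChoice.util_le (hf : I.IsChoice θ f) {t : Fin m} {y : Fin n} (h : I.Alive θ t y) :
    I.util t y ≤ I.utilOf t (f t) := (hf t).2 y y.isLt h

/-- Two best alive courses have equal positive utility, hence coincide. This lets a round without
rejections for the computed choice establish `Settled`, which speaks of all choices. -/
theorem IsChoice.unique (hu : I.DistinctUtils) {f' : Matching n m} (hf : I.IsChoice θ f)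
    (hf' : I.IsChoice θ f') : f = f' := by
  funext t
  cases h : f t with
  | none =>
    cases h' : f' t with
    | none => rfl
    | some y =>
      have := hf.util_le (hf'.alive h')
      rw [h] at this
      exact absurd (Nat.le_zero.1 this) (hf'.alive h').1
  | some x =>
    have hx := hf.alive h
    have h1 := hf'.util_le hx
    cases h' : f' t with
    | none =>
      rw [h'] at h1
      exact absurd (Nat.le_zero.1 h1) hx.1
    | some y =>
      have hy := hf'.alive h'
      have h2 := hf.util_le hy
      rw [h'] at h1
      rw [h] at h2
      exact congrArg some
        (hu t (Nat.pos_of_ne_zero hx.1) (Nat.pos_of_ne_zero hy.1) (le_antisymm h1 h2))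

/-! ### Rejections spare the pairs of fair matchings. -/

theorem FairAt.sum_nonneg (h : I.FairAt (I.k : ℝ) μ) (x : Fin n) :
    0 ≤ ∑ t ∈ assigned μ x, ((I.val x t : ℝ) - (I.k : ℝ)) := by
  have h1 := h.2.2 x
  have hc : (0 : ℝ) < I.cap x := by exact_mod_cast I.cap_pos x
  rw [avgUtil, le_div_iff₀ hc] at h1
  -- For exactly `cap x` TAs the summed excess over `k` is `cap x` times the excess of the average.
  -- This form can be tested without multiplication or division.
  rw [Finset.sum_sub_distrib, Finset.sum_const, nsmul_eq_mul, h.1.1 x]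
  linarith

/-- Fair matchings do not contain any pair that is excluded by rejections. -/
theorem FairAt.lt_of_rejects (hu : I.DistinctUtils) (hμ : I.FairAt (I.k : ℝ) μ)
    (halive : ∀ t x, μ t = some x → I.Alive θ t x) (hf : I.IsChoice θ f) {x : Fin n}
    (hx : I.Rejects f x) {b : ℝ}
    (hb : IsLeast ((fun t => (I.grade t x : ℝ) + 1) '' (assigned f x : Set (Fin m))) b)
    {t' : Fin m} (ht' : μ t' = some x) : b < (I.grade t' x : ℝ) + 1 := by
  by_contra! hle
  -- Otherwise the two sets agree by cardinality, and `x` would have no reason to reject.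
  have hex : ∃ t ∈ assigned f x, t ∉ assigned μ x := by
    by_contra! hsub
    have hcard := hμ.1.1 x
    have heq : assigned f x = assigned μ x :=
      Finset.eq_of_subset_of_card_le hsub (hcard.trans_le hx.1)
    exact hx.2 ⟨by rw [heq, hcard], by rw [heq]; exact hμ.sum_nonneg x⟩
  obtain ⟨t, htf, htμ⟩ := hex
  have hbt : b ≤ (I.grade t x : ℝ) + 1 := hb.2 ⟨t, htf, rfl⟩
  rw [mem_assigned] at htf htμ
  have hal := hf.alive htf
  -- `t` envies `t'`: the grade is at least as high, and distinct utilities turn the weak preference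
  -- for `x` into a strict one.
  refine hμ.2.1 t t' ⟨x, ht', by exact_mod_cast (by linarith :
    (I.grade t' x : ℝ) ≤ I.grade t x), ?_⟩
  cases h : μ t with
  | none => exact Nat.pos_of_ne_zero hal.1
  | some y =>
    have hy := halive t y h
    have hle' := hf.util_le hy
    rw [htf] at hle'
    refine lt_of_le_of_ne hle' fun he => htμ ?_
    rw [h, hu t (Nat.pos_of_ne_zero hy.1) (Nat.pos_of_ne_zero hal.1) he]

theorem KeepsFair.raise (hu : I.DistinctUtils) (h : I.KeepsFair θ) (hf : I.IsChoice θ f)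
    (hr : ∀ x, I.IsRaised f x (θ x) (θ' x)) : I.KeepsFair θ' := by
  intro μ hμ t x htx
  refine ⟨hμ.1.2 t x htx, ?_⟩
  by_cases hx : I.Rejects f x
  · exact hμ.lt_of_rejects hu (h μ hμ) hf hx ((hr x).1 hx) htx
  · rw [(hr x).2 hx]
    exact (h μ hμ t x htx).2

/-! ### Progress: counting alive pairs. -/

theorem IsRaised.exists_rejected {x : Fin n} {a b : ℝ} (h : I.IsRaised f x a b)
    (hx : I.Rejects f x) : ∃ t, f t = some x ∧ b = (I.grade t x : ℝ) + 1 := by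
  obtain ⟨t, ht, hbt⟩ := (h.1 hx).1
  exact ⟨t, mem_assigned.1 ht, hbt.symm⟩

theorem IsRaised.le (hf : I.IsChoice θ f) {x : Fin n} {b : ℝ} (h : I.IsRaised f x (θ x) b) :
    θ x ≤ b := by
  by_cases hx : I.Rejects f x
  · obtain ⟨t, ht, rfl⟩ := h.exists_rejected hx
    exact (hf.alive ht).2.le
  · exact (h.2 hx).ge

/-- Thresholds never fall, and the lowest-graded applicant of `x` was alive but now lies exactly on
the threshold, which `Alive` excludes. -/
theorem aliveCount_lt (hf : I.IsChoice θ f) (hr : ∀ x, I.IsRaised f x (θ x) (θ' x)) {x : Fin n}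
    (hx : I.Rejects f x) : I.aliveCount θ' < I.aliveCount θ := by
  classical
  obtain ⟨t, ht, hb⟩ := (hr x).exists_rejected hx
  refine Finset.card_lt_card ((Finset.ssubset_iff_of_subset ?_).2 ⟨(t, x), ?_, ?_⟩)
  · intro p hp
    simp only [Finset.mem_filter, Finset.mem_univ, true_and] at hp ⊢
    exact ⟨hp.1, ((hr p.2).le hf).trans_lt hp.2⟩
  · simpa using hf.alive ht
  · exact fun hp => (Finset.mem_filter.1 hp).2.2.ne hb

/-- A round either kills a pair or changes nothing. In the latter case the state is settled and
stays so, which permits a fixed number of rounds without a stopping test. -/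
theorem Reached.raise (hu : I.DistinctUtils) {r : ℕ} (h : I.Reached r θ) (hf : I.IsChoice θ f)
    (hr : ∀ x, I.IsRaised f x (θ x) (θ' x)) : I.Reached (r + 1) θ' := by
  refine ⟨h.1.raise hu hf hr, ?_⟩
  by_cases hx : ∃ x, I.Rejects f x
  · obtain ⟨x, hx⟩ := hx
    have hlt := aliveCount_lt hf hr hx
    rcases h.2 with hs | hc
    · exact absurd hx (hs f hf x)
    · right; omega
  · push Not at hx
    have hθ : θ' = θ := funext fun x => (hr x).2 (hx x)
    subst hθ
    refine Or.inl fun f' hf' x => ?_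
    rw [hf'.unique hu hf]
    exact hx x

theorem reached_zero : I.Reached 0 fun _ => 0 := by
  classical
  refine ⟨fun μ hμ t x h => ⟨hμ.1.2 t x h, by positivity⟩, Or.inr ?_⟩
  refine (Finset.card_le_univ _).trans ?_
  simp

/-- If the count has dropped to zero, nobody can choose a course, while a rejection needs at least
`cap x ≥ 1` applicants. -/
theorem Reached.settled (h : I.Reached (m * n) θ) : I.Settled θ := by
  classical
  rcases h.2 with hs | hc
  · exact hs
  · intro f hf x hx
    have h0 : I.aliveCount θ = 0 := by omega
    rw [aliveCount, Finset.card_eq_zero, Finset.filter_eq_empty_iff] at h0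
    obtain ⟨t, ht⟩ := Finset.card_pos.1 ((I.cap_pos x).trans_le hx.1)
    exact h0 (Finset.mem_univ (t, x)) (hf.alive (mem_assigned.1 ht))

/-! ### Fairness of the settled choices. -/

theorem sum_card_assigned (f : Matching n m) :
    ∑ x, (assigned f x).card = (Finset.univ.filter fun t => f t ≠ none).card := by
  classical
  rw [← Finset.card_biUnion]
  · congr 1
    ext t
    simp [assigned, Option.ne_none_iff_exists']
  · intro x _ y _ hxy
    refine Finset.disjoint_left.2 fun t hx hy => hxy ?_
    rw [mem_assigned] at hx hy
    exact Option.some_injective _ (hx.symm.trans hy)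

/-- Once no course rejects any TA, the choices of the TAs form a fair matching, if there is one. -/
theorem Settled.fairAt (hs : I.Settled θ) (hk : I.KeepsFair θ) (hf : I.IsChoice θ f)
    (hyes : I.IsYes) : I.FairAt (I.k : ℝ) f := by
  obtain ⟨μ, hμ⟩ := hyes
  have hle : ∀ x, (assigned f x).card ≤ I.cap x := by
    intro x
    by_contra! hlt
    exact hs f hf x ⟨hlt.le, fun h => absurd h.1 hlt.not_ge⟩
  -- A TA assigned by `μ` still has an alive course and hence chooses one, so at least as many TAs
  -- are assigned by `f`. Together with `hle` this forces equality at every course.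
  have hsum : ∑ x, I.cap x ≤ ∑ x, (assigned f x).card := by
    have hμc : ∑ x, I.cap x = ∑ x, (assigned μ x).card :=
      Finset.sum_congr rfl fun x _ => (hμ.1.1 x).symm
    rw [hμc, sum_card_assigned, sum_card_assigned]
    refine Finset.card_le_card fun t ht => ?_
    simp only [Finset.mem_filter, Finset.mem_univ, true_and] at ht ⊢
    obtain ⟨x, hx⟩ := Option.ne_none_iff_exists'.1 ht
    intro hnone
    have hal := hk μ hμ t x hx
    have := hf.util_le hal
    rw [hnone] at this
    exact hal.1 (Nat.le_zero.1 this)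
  have hcard : ∀ x, (assigned f x).card = I.cap x := fun x =>
    (Finset.sum_eq_sum_iff_of_le fun x _ => hle x).1
      (le_antisymm (Finset.sum_le_sum fun x _ => hle x) hsum) x (Finset.mem_univ x)
  refine ⟨⟨hcard, fun t x h => (hf.alive h).1⟩, ?_, fun x => ?_⟩
  · rintro t t' ⟨x, ht', hg, hlt⟩
    have hg' : (I.grade t' x : ℝ) ≤ I.grade t x := by exact_mod_cast hg
    have hal := (hf.alive ht').2
    -- The threshold of `x` admits `t'`, hence also `t`, whose grade is no lower. So `x` was
    -- available to `t`.
    exact hlt.not_ge (hf.util_le ⟨(Nat.zero_le _ |>.trans_lt hlt).ne', by linarith⟩)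
  · have hpos : 0 ≤ ∑ t ∈ assigned f x, ((I.val x t : ℝ) - (I.k : ℝ)) := by
      by_contra hneg
      exact hs f hf x ⟨(hcard x).ge, fun h => hneg h.2⟩
    have hc : (0 : ℝ) < I.cap x := by exact_mod_cast I.cap_pos x
    rw [Finset.sum_sub_distrib, Finset.sum_const, nsmul_eq_mul, hcard x] at hpos
    rw [avgUtil, le_div_iff₀ hc]
    linarith

theorem FairAt.mono {a b : ℝ} (hab : a ≤ b) (h : I.FairAt b f) : I.FairAt a f :=
  ⟨h.1, h.2.1, fun x => hab.trans (h.2.2 x)⟩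

end Instance

/-! ### Total correctness with a time bound -/

/-- The program `p`, started in `s`, halts after at most `c` steps in a memory satisfying `Q`. -/
def Ends (p : Prog) (s : Store) (c : ℕ) (Q : Store → Prop) : Prop :=
  ∃ N s', Runs p s N s' ∧ N ≤ c ∧ Q s'

variable {p q : Prog} {s : Store} {c c₁ c₂ : ℕ} {Q R : Store → Prop}

theorem Ends.mono (h : Ends p s c₁ Q) (hc : c₁ ≤ c₂) (hQ : ∀ s', Q s' → R s') :
    Ends p s c₂ R := by
  obtain ⟨N, s', hr, hN, hs⟩ := h
  exact ⟨N, s', hr, hN.trans hc, hQ s' hs⟩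

theorem Ends.nop (h : Q s) : Ends .nop s 1 Q := ⟨_, _, Runs.nop s, le_rfl, h⟩

theorem Ends.setNat {a : ℕ} {i j e : NExpr} (h : Q (s.setNat a (i.eval s) (j.eval s) (e.eval s))) :
    Ends (.setNat a i j e) s (1 + i.cost + j.cost + e.cost) Q :=
  ⟨_, _, Runs.setNat a i j e s, le_rfl, h⟩

theorem Ends.setDat {a : ℕ} {i j : NExpr} {e : DExpr}
    (h : Q (s.setDat a (i.eval s) (j.eval s) (e.eval s))) :
    Ends (.setDat a i j e) s (1 + i.cost + j.cost + e.cost) Q :=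
  ⟨_, _, Runs.setDat a i j e s, le_rfl, h⟩

theorem Ends.seq (hp : Ends p s c₁ R) (hq : ∀ s', R s' → Ends q s' c₂ Q) :
    Ends (.seq p q) s (c₁ + c₂) Q := by
  obtain ⟨N₁, s₁, hr₁, hN₁, hs₁⟩ := hp
  obtain ⟨N₂, s₂, hr₂, hN₂, hs₂⟩ := hq s₁ hs₁
  exact ⟨_, s₂, .seq hr₁ hr₂, Nat.add_le_add hN₁ hN₂, hs₂⟩

theorem Ends.branch {b : Test} (hp : b.Holds s → Ends p s c Q) (hq : ¬ b.Holds s → Ends q s c Q) :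
    Ends (.branch b p q) s (1 + b.cost + c) Q := by
  by_cases hb : b.Holds s
  · obtain ⟨N, s', hr, hN, hs⟩ := hp hb
    exact ⟨_, s', .branchTrue hb hr, Nat.add_le_add_left hN _, hs⟩
  · obtain ⟨N, s', hr, hN, hs⟩ := hq hb
    exact ⟨_, s', .branchFalse hb hr, Nat.add_le_add_left hN _, hs⟩

/-- A scalar variable holding a natural number. -/
def nvar (a : ℕ) : NExpr := .read a (.const 0) (.const 0)

/-- A scalar variable holding data. -/
def dvar (a : ℕ) : DExpr := .read a (.const 0) (.const 0)

/-- Run `p` for the values `0, …, bound - 1` of the scalar variable `a`. -/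
def forLoop (a : ℕ) (bound : NExpr) (p : Prog) : Prog :=
  .seq (.setNat a (.const 0) (.const 0) (.const 0))
    (.loop (.neg (.leNat bound (nvar a)))
      (.seq p (.setNat a (.const 0) (.const 0) (.add (nvar a) (.const 1)))))

/-- `Inv` does not depend on the scalar variable `a`. -/
def Ignores (a : ℕ) (Inv : Store → Prop) : Prop :=
  ∀ s x, Inv s → Inv (s.setNat a 0 0 x)

/-- An iteration adds 17 steps to the body: 9 for the test and 8 for the increment. The final
failing test costs 9. -/
theorem Ends.loop {a b : ℕ} {bound : NExpr} {Inv : ℕ → Store → Prop}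
    (hcost : bound.cost = 3) (hign : ∀ i, Ignores a (Inv i))
    (hbound : ∀ i s, Inv i s → bound.eval s = b)
    (hbody : ∀ i s, i < b → Inv i s → s.nat a 0 0 = i →
      Ends p s c fun s' => Inv (i + 1) s' ∧ s'.nat a 0 0 = i) :
    ∀ k i s, i + k = b → Inv i s → s.nat a 0 0 = i →
      Ends (.loop (.neg (.leNat bound (nvar a)))
        (.seq p (.setNat a (.const 0) (.const 0) (.add (nvar a) (.const 1))))) s
        (k * (c + 17) + 9) (Inv b) := by
  intro k
  induction k with
  | zero =>
    intro i s hi hs ha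
    obtain rfl : i = b := by omega
    refine ⟨_, s, .loopFalse ?_, ?_, hs⟩
    · simp [Test.Holds, nvar, NExpr.eval, hbound i s hs, ha]
    · simp [Test.cost, nvar, NExpr.cost, hcost]
  | succ k ih =>
    intro i s hi hs ha
    obtain ⟨N₁, s₁, hr₁, hN₁, hs₁, ha₁⟩ := hbody i s (by omega) hs ha
    obtain ⟨N₂, s₂, hr₂, hN₂, hs₂⟩ := ih (i + 1) (s₁.setNat a 0 0 (i + 1)) (by omega)
      (hign _ _ _ hs₁) (by simp [Store.setNat])
    have hinc := Runs.setNat a (.const 0) (.const 0) (.add (nvar a) (.const 1)) s₁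
    simp only [NExpr.eval, nvar, ha₁] at hinc
    refine ⟨_, s₂, .loopTrue ?_ (.seq hr₁ hinc) hr₂, ?_, hs₂⟩
    · simp only [Test.Holds, nvar, NExpr.eval, hbound i s hs, ha]
      omega
    · simp only [Test.cost, nvar, NExpr.cost, hcost, add_mul]
      omega

theorem Ends.forLoop {a b : ℕ} {bound : NExpr} (Inv : ℕ → Store → Prop)
    (hcost : bound.cost = 3) (hign : ∀ i, Ignores a (Inv i))
    (hbound : ∀ i s, Inv i s → bound.eval s = b)
    (hbody : ∀ i s, i < b → Inv i s → s.nat a 0 0 = i →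
      Ends p s c fun s' => Inv (i + 1) s' ∧ s'.nat a 0 0 = i)
    (h0 : Inv 0 s) (hQ : ∀ s', Inv b s' → Q s') :
    Ends (MEFE.forLoop a bound p) s ((b + 1) * (c + 17)) Q := by
  have hinit : Ends (.setNat a (.const 0) (.const 0) (.const 0)) s 4
      fun s' => Inv 0 s' ∧ s'.nat a 0 0 = 0 :=
    Ends.setNat ⟨hign 0 s 0 h0, by simp [Store.setNat, NExpr.eval]⟩
  refine (hinit.seq fun s' h => Ends.loop hcost hign hbound hbody b 0 s' (by omega) h.1 h.2).mono
    ?_ hQ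
  -- Initialization and the failing test cost 4 + 9, which the extra summand `c + 17` covers.
  rw [add_mul]
  omega

/-! ### The program -/

/-- The number of courses. -/
def numCourses : NExpr := .read 0 (.const 0) (.const 0)

/-- The number of TAs. -/
def numTAs : NExpr := .read 0 (.const 0) (.const 1)

/-- The current TA. -/
def curTA : NExpr := nvar 5

/-- The current course. -/
def curCourse : NExpr := nvar 6

/-- The grade of the current TA in the current course, plus one. -/
def curGrade : DExpr := .add (.read 2 curTA curCourse) (.ofNat (.const 1))

/-- The utility of the current TA for the current course. -/
def curUtil : DExpr := .read 1 curTA curCourse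

/-- Let the current TA choose the current course if that course is the best so far. -/
def considerProg : Prog :=
  .branch (.conj (.neg (.leDat curGrade (.read 4 curCourse (.const 0))))
      (.neg (.leDat curUtil (dvar 7))))
    (.seq (.setNat 2 curTA (.const 0) (.add curCourse (.const 1)))
      (.setDat 7 (.const 0) (.const 0) curUtil))
    .nop

/-- Compute the choices of all TAs. -/
def chooseProg : Prog :=
  forLoop 5 numTAs
    (.seq (.seq (.setNat 2 curTA (.const 0) (.const 0))
        (.setDat 7 (.const 0) (.const 0) (.ofNat (.const 0))))
      (forLoop 6 numCourses considerProg))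

/-- Take the current TA into account for the number of TAs that choose the current course, the
excess of their valuations over the threshold, and their minimal grade. -/
def tallyProg : Prog :=
  .branch (.conj (.leNat (.read 2 curTA (.const 0)) (.add curCourse (.const 1)))
      (.leNat (.add curCourse (.const 1)) (.read 2 curTA (.const 0))))
    (.seq
      (.branch (.conj (.leNat (.const 1) (nvar 7)) (.leDat (dvar 6) curGrade))
        .nop (.setDat 6 (.const 0) (.const 0) curGrade))
      (.seq (.setNat 7 (.const 0) (.const 0) (.add (nvar 7) (.const 1)))
        (.setDat 5 (.const 0) (.const 0)
          (.add (dvar 5) (.sub (.read 0 curCourse curTA) (dvar 3))))))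
    .nop

/-- Raise the threshold of the current course if the course rejects TAs. -/
def rejectProg : Prog :=
  .branch (.conj (.leNat (.read 1 curCourse (.const 0)) (nvar 7))
      (.neg (.conj (.leNat (nvar 7) (.read 1 curCourse (.const 0)))
        (.leDat (.ofNat (.const 0)) (dvar 5)))))
    (.setDat 4 curCourse (.const 0) (dvar 6))
    .nop

/-- Raise the thresholds of all courses that reject TAs. -/
def raiseProg : Prog :=
  forLoop 6 numCourses
    (.seq (.seq (.setNat 7 (.const 0) (.const 0) (.const 0))
        (.setDat 5 (.const 0) (.const 0) (.ofNat (.const 0))))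
      (.seq (forLoop 5 numTAs tallyProg) rejectProg))

/-- Deferred acceptance with rejections of unsatisfactory sets. -/
def matchProg : Prog :=
  .seq (forLoop 3 numTAs (forLoop 4 numCourses (.seq chooseProg raiseProg))) chooseProg

/-! ### Invariants -/

variable {n m : ℕ} {I : Instance n m} {θ θ' : Fin n → ℝ} {f : Matching n m}

/-- The memory contains the instance and the thresholds. -/
structure Stored (I : Instance n m) (θ : Fin n → ℝ) (s : Store) : Prop where
  numCourses : s.nat 0 0 0 = n
  numTAs : s.nat 0 0 1 = m
  cap : ∀ x : Fin n, s.nat 1 x 0 = I.cap x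
  val : ∀ (x : Fin n) (t : Fin m), s.dat 0 x t = I.val x t
  util : ∀ (t : Fin m) (x : Fin n), s.dat 1 t x = I.util t x
  grade : ∀ (t : Fin m) (x : Fin n), s.dat 2 t x = I.grade t x
  threshold : s.dat 3 0 0 = I.k
  thr : ∀ x : Fin n, s.dat 4 x 0 = θ x

/-- Memory layout. Natural numbers: 0 and 1 are input, 2 the choices, 3 and 4 the round counters, 5
the TA, 6 the course, 7 the number of applicants. Data: 0 to 3 are input, 4 the thresholds, 5 the
summed excess, 6 the lowest shifted grade, 7 the best utility so far. -/
theorem Stored.setNat (h : Stored I θ s) {a i j x : ℕ} (ha : 1 < a) :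
    Stored I θ (s.setNat a i j x) where
  numCourses := by simpa [Store.setNat, show 0 ≠ a by omega] using h.numCourses
  numTAs := by simpa [Store.setNat, show 0 ≠ a by omega] using h.numTAs
  cap := by simpa [Store.setNat, show 1 ≠ a by omega] using h.cap
  val := h.val
  util := h.util
  grade := h.grade
  threshold := h.threshold
  thr := h.thr

theorem Stored.setDat (h : Stored I θ s) {a i j : ℕ} {x : ℝ} (ha : 4 < a) :
    Stored I θ (s.setDat a i j x) where
  numCourses := h.numCourses
  numTAs := h.numTAs
  cap := h.cap
  val := by simpa [Store.setDat, show 0 ≠ a by omega] using h.val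
  util := by simpa [Store.setDat, show 1 ≠ a by omega] using h.util
  grade := by simpa [Store.setDat, show 2 ≠ a by omega] using h.grade
  threshold := by simpa [Store.setDat, show 3 ≠ a by omega] using h.threshold
  thr := by simpa [Store.setDat, show 4 ≠ a by omega] using h.thr

theorem Stored.setThreshold (h : Stored I θ s) (x : Fin n) (b : ℝ) :
    Stored I (Function.update θ x b) (s.setDat 4 x 0 b) where
  numCourses := h.numCourses
  numTAs := h.numTAs
  cap := h.cap
  val := by simpa [Store.setDat] using h.val
  util := by simpa [Store.setDat] using h.util
  grade := by simpa [Store.setDat] using h.grade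
  threshold := by simpa [Store.setDat] using h.threshold
  thr y := by simp [Store.setDat, Function.update_apply, h.thr, Fin.ext_iff]

/-- The thresholds need no initialization: unused cells hold 0, which excludes nobody. -/
theorem stored_encode (I : Instance n m) (ε : ℝ) : Stored I (fun _ => 0) (encode I ε) where
  numCourses := by simp [encode]
  numTAs := by simp [encode]
  cap x := by simp [encode]
  val x t := by simp [encode]
  util t x := by simp [encode]
  grade t x := by simp [encode]
  threshold := by simp [encode]
  thr x := by simp [encode]

/-- Output format of an assignment. -/
def code : Option (Fin n) → ℕ
  | none => 0
  | some x => x + 1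

theorem code_eq_succ_iff {o : Option (Fin n)} {x : Fin n} : code o = x + 1 ↔ o = some x := by
  cases o <;> simp [code, Fin.ext_iff]

/-- The memory contains the matching `f`. -/
def Writes (f : Matching n m) (s : Store) : Prop :=
  ∀ t : Fin m, s.nat 2 t 0 = code (f t)

theorem Writes.decode_eq (h : Writes f s) : decode n m s = f := by
  funext t
  cases hf : f t with
  | none => simp [decode, h t, hf, code]
  | some x => simp [decode, h t, hf, code]

end MEFE

namespace MEFE

open Instance

variable {n m : ℕ} {I : Instance n m} {θ θ' : Fin n → ℝ} {f : Matching n m} {s : Store} {u v : ℕ}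

/-- The memory contains the instance and the thresholds, and the loop variables of the rounds have
the values `u` and `v`. -/
def Ready (I : Instance n m) (θ : Fin n → ℝ) (u v : ℕ) (s : Store) : Prop :=
  Stored I θ s ∧ s.nat 3 0 0 = u ∧ s.nat 4 0 0 = v

theorem Ready.setNat (h : Ready I θ u v s) {a i j x : ℕ} (ha : 1 < a) (h3 : 3 ≠ a) (h4 : 4 ≠ a) :
    Ready I θ u v (s.setNat a i j x) :=
  ⟨h.1.setNat ha, by simpa [Store.setNat, h3] using h.2.1, by simpa [Store.setNat, h4] using h.2.2⟩

theorem Ready.setDat (h : Ready I θ u v s) {a i j : ℕ} {x : ℝ} (ha : 4 < a) :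
    Ready I θ u v (s.setDat a i j x) :=
  ⟨h.1.setDat ha, h.2⟩

theorem Ready.setThreshold (h : Ready I θ u v s) (x : Fin n) (b : ℝ) :
    Ready I (Function.update θ x b) u v (s.setDat 4 x 0 b) :=
  ⟨h.1.setThreshold x b, h.2⟩

theorem Writes.setNat (h : Writes f s) {a i j x : ℕ} (ha : 2 ≠ a) : Writes f (s.setNat a i j x) := by
  simpa [Writes, Store.setNat, ha] using h

/-! ### Choosing -/

/-- The choices of the first `j` TAs are final. -/
def Chosen (I : Instance n m) (θ : Fin n → ℝ) (j : ℕ) (s : Store) : Prop :=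
  ∀ t : Fin m, t.val < j → ∃ o, s.nat 2 t 0 = code o ∧ I.IsBest θ t n o

/-- The state of the computation after the TA `t` has considered the first `j` courses. -/
def Considering (I : Instance n m) (θ : Fin n → ℝ) (u v : ℕ) (t : Fin m) (j : ℕ) (s : Store) :
    Prop :=
  Ready I θ u v s ∧ Chosen I θ t s ∧ s.nat 5 0 0 = t ∧
    ∃ o, s.nat 2 t 0 = code o ∧ s.dat 7 0 0 = I.utilOf t o ∧ I.IsBest θ t j o

theorem Chosen.setNat {j : ℕ} (h : Chosen I θ j s) {a i x : ℕ} (ha : 2 ≠ a ∨ j ≤ i) :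
    Chosen I θ j (s.setNat a i 0 x) := by
  intro t ht
  obtain ⟨o, ho, hb⟩ := h t ht
  refine ⟨o, ?_, hb⟩
  rw [← ho]
  simp only [Store.setNat]
  rw [if_neg]
  omega

theorem Chosen.exists_isChoice (h : Chosen I θ m s) : ∃ f, Writes f s ∧ I.IsChoice θ f := by
  choose f hf using fun t => h t t.isLt
  exact ⟨f, fun t => (hf t).1, fun t => (hf t).2⟩

theorem ends_considerProg {t : Fin m} {j : ℕ} (hj : j < n) (hs : Considering I θ u v t j s)
    (h6 : s.nat 6 0 0 = j) :
    Ends considerProg s 60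
      fun s' => Considering I θ u v t (j + 1) s' ∧ s'.nat 6 0 0 = j := by
  obtain ⟨hr, hc, h5, o, ho, h7, hb⟩ := hs
  have hgrade := hr.1.grade t ⟨j, hj⟩
  have hutil := hr.1.util t ⟨j, hj⟩
  have hthr := hr.1.thr ⟨j, hj⟩
  simp only at hgrade hutil hthr
  refine (Ends.branch (c := 20) ?_ ?_).mono ?_ fun _ h => h
  · intro htest
    simp only [Test.Holds, curGrade, curUtil, curCourse, curTA, nvar, dvar, DExpr.eval, NExpr.eval,
      h5, h6, h7, hgrade, hutil, hthr, not_le, Nat.cast_one, Nat.cast_lt] at htest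
    refine (Ends.seq (Ends.setNat (Q := fun s' => s' = s.setNat 2 t 0 (j + 1)) ?_)
      fun s' hs' => Ends.setDat (Q := fun s'' =>
        s'' = (s.setNat 2 t 0 (j + 1)).setDat 7 0 0 (I.util t ⟨j, hj⟩)) ?_).mono ?_ ?_
    · simp [curCourse, curTA, nvar, NExpr.eval, h5, h6]
    · subst hs'
      simp [curUtil, curCourse, curTA, nvar, NExpr.eval, DExpr.eval, h5, h6, hutil, Store.setNat]
    · simp [curUtil, curCourse, curTA, nvar, NExpr.cost, DExpr.cost]
    · rintro s' rfl
      refine ⟨⟨(hr.setNat (by decide) (by decide) (by decide)).setDat (by decide),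
        fun t' ht' => hc.setNat (Or.inr le_rfl) t' ht', ?_, some ⟨j, hj⟩, ?_, ?_, ?_, ?_⟩, ?_⟩
      · simp [Store.setNat, Store.setDat, h5]
      · simp [Store.setNat, Store.setDat, code]
      · simp [Store.setNat, Store.setDat, utilOf]
      · intro x hx
        obtain rfl := Option.some_injective _ hx
        -- The running maximum starts at 0 and is beaten strictly, so acceptability needs no
        -- separate test.
        exact ⟨(Nat.zero_le _ |>.trans_lt htest.2).ne', htest.1⟩
      · intro y hy hal
        rcases (Nat.lt_succ_iff_lt_or_eq.1 hy) with hlt | heq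
        · exact (hb.2 y hlt hal).trans htest.2.le
        · obtain rfl : y = ⟨j, hj⟩ := Fin.ext heq
          exact le_rfl
      · simp [Store.setNat, Store.setDat, h6]
  · intro htest
    simp only [Test.Holds, curGrade, curUtil, curCourse, curTA, nvar, dvar, DExpr.eval, NExpr.eval,
      h5, h6, h7, hgrade, hutil, hthr, not_le, Nat.cast_one, Nat.cast_lt] at htest
    refine (Ends.nop ⟨⟨hr, hc, h5, o, ho, h7, hb.1, fun y hy hal => ?_⟩, h6⟩).mono (by decide)
      fun _ h => h
    rcases (Nat.lt_succ_iff_lt_or_eq.1 hy) with hlt | heq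
    · exact hb.2 y hlt hal
    · obtain rfl : y = ⟨j, hj⟩ := Fin.ext heq
      exact not_lt.1 fun h => htest ⟨hal.2, h⟩
  · simp [Test.cost, curGrade, curUtil, curCourse, curTA, nvar, dvar, NExpr.cost, DExpr.cost]

theorem Considering.ignores {t : Fin m} (j : ℕ) : Ignores 6 (Considering I θ u v t j) := by
  rintro s x ⟨hr, hc, h5, ho⟩
  exact ⟨hr.setNat (by decide) (by decide) (by decide), hc.setNat (Or.inl (by decide)),
    by simpa [Store.setNat] using h5, by simpa [Store.setNat] using ho⟩

theorem ends_chooseProg (hs : Ready I θ u v s) :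
    Ends chooseProg s ((m + 1) * (11 + (n + 1) * (60 + 17) + 17))
      fun s' => Ready I θ u v s' ∧ ∃ f, Writes f s' ∧ I.IsChoice θ f := by
  refine Ends.forLoop (fun j s' => Ready I θ u v s' ∧ Chosen I θ j s') rfl ?_ ?_ ?_
    ⟨hs, fun t ht => absurd ht (Nat.not_lt_zero _)⟩ fun s' h => ⟨h.1, h.2.exists_isChoice⟩
  · rintro i s x ⟨hr, hc⟩
    exact ⟨hr.setNat (by decide) (by decide) (by decide), hc.setNat (Or.inl (by decide))⟩
  · rintro i s ⟨hr, -⟩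
    exact hr.1.numTAs
  · rintro i s hi ⟨hr, hc⟩ h5
    refine Ends.seq (R := Considering I θ u v ⟨i, hi⟩ 0) ?_ fun s' hs' =>
      Ends.forLoop (Considering I θ u v ⟨i, hi⟩) rfl Considering.ignores
        (fun j s h => h.1.1.numCourses) (fun j s hj h h6 => ends_considerProg hj h h6) hs' ?_
    · refine (Ends.seq (Ends.setNat (Q := fun s' => s' = s.setNat 2 i 0 0) ?_)
        fun s' hs' => Ends.setDat (Q := fun s'' =>
          s'' = (s.setNat 2 i 0 0).setDat 7 0 0 0) ?_).mono ?_ ?_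
      · simp [curTA, nvar, NExpr.eval, h5]
      · simp [DExpr.eval, NExpr.eval, hs']
      · simp [curTA, nvar, NExpr.cost, DExpr.cost]
      · rintro s' rfl
        refine ⟨(hr.setNat (by decide) (by decide) (by decide)).setDat (by decide),
          fun t' ht' => hc.setNat (Or.inr le_rfl) t' ht', ?_, none, ?_, ?_, ?_, ?_⟩
        · simp [Store.setNat, Store.setDat, h5]
        · simp [Store.setNat, Store.setDat, code]
        · simp [Store.setNat, Store.setDat, utilOf]
        · simp
        · simp
    · rintro s' ⟨hr', hc', h5', o, ho, -, hb⟩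
      refine ⟨⟨hr', fun t ht => ?_⟩, h5'⟩
      rcases (Nat.lt_succ_iff_lt_or_eq.1 ht) with hlt | heq
      · exact hc' t hlt
      · obtain rfl : t = ⟨i, hi⟩ := Fin.ext heq
        exact ⟨o, ho, hb⟩

/-! ### Rejecting -/

/-- The first `j` TAs that choose the course `x`. -/
def assignedBelow (f : Matching n m) (x : Fin n) (j : ℕ) : Finset (Fin m) :=
  Finset.univ.filter fun t => f t = some x ∧ t.val < j

theorem assignedBelow_zero (x : Fin n) : assignedBelow f x 0 = ∅ := by
  simp [assignedBelow]

theorem assignedBelow_all (x : Fin n) : assignedBelow f x m = assigned f x := by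
  simp [assignedBelow, assigned]

theorem assignedBelow_succ_of_ne {x : Fin n} {t : Fin m} (h : f t ≠ some x) :
    assignedBelow f x (t + 1) = assignedBelow f x t := by
  ext t'
  simp only [assignedBelow, Finset.mem_filter, Finset.mem_univ, true_and, Nat.lt_succ_iff_lt_or_eq]
  refine ⟨fun ⟨h1, h2⟩ => ⟨h1, h2.resolve_right fun he => h ?_⟩, fun ⟨h1, h2⟩ => ⟨h1, Or.inl h2⟩⟩
  rw [← h1, Fin.ext he]

theorem assignedBelow_succ {x : Fin n} {t : Fin m} (h : f t = some x) :
    assignedBelow f x (t + 1) = insert t (assignedBelow f x t) := by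
  ext t'
  simp only [assignedBelow, Finset.mem_filter, Finset.mem_univ, true_and, Finset.mem_insert,
    Nat.lt_succ_iff_lt_or_eq, ← Fin.ext_iff]
  constructor
  · rintro ⟨h1, h2 | h2⟩
    · exact Or.inr ⟨h1, h2⟩
    · exact Or.inl h2
  · rintro (rfl | ⟨h1, h2⟩)
    · exact ⟨h, Or.inr rfl⟩
    · exact ⟨h1, Or.inl h2⟩

theorem notMem_assignedBelow (x : Fin n) (t : Fin m) : t ∉ assignedBelow f x t := by
  simp [assignedBelow]

/-- Number, excess and minimal shifted grade of the first `j` TAs that choose `x`. -/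
def Tally (I : Instance n m) (f : Matching n m) (x : Fin n) (j cnt : ℕ) (acc low : ℝ) : Prop :=
  cnt = (assignedBelow f x j).card ∧
    acc = ∑ t ∈ assignedBelow f x j, ((I.val x t : ℝ) - (I.k : ℝ)) ∧
    (0 < cnt →
      IsLeast ((fun t => (I.grade t x : ℝ) + 1) '' (assignedBelow f x j : Set (Fin m))) low)

/-- The state of the computation after the course `x` has tallied the first `j` TAs. -/
def Tallying (I : Instance n m) (θ : Fin n → ℝ) (u v : ℕ) (f : Matching n m) (x : Fin n) (j : ℕ)
    (s : Store) : Prop :=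
  Ready I θ u v s ∧ Writes f s ∧ s.nat 6 0 0 = x ∧
    Tally I f x j (s.nat 7 0 0) (s.dat 5 0 0) (s.dat 6 0 0)

/-- The cell of the minimum is not reset between courses. Its content is meaningless while the count
is 0, whence the two cases for `low'`. -/
theorem Tally.succ {x : Fin n} {t : Fin m} {cnt : ℕ} {acc low low' : ℝ}
    (h : Tally I f x t cnt acc low) (ht : f t = some x)
    (h1 : 0 < cnt → low' = min low (I.grade t x + 1)) (h0 : cnt = 0 → low' = I.grade t x + 1) :
    Tally I f x (t + 1) (cnt + 1) (acc + (I.val x t - I.k)) low' := by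
  obtain ⟨hc, ha, hl⟩ := h
  have hnot := notMem_assignedBelow (f := f) x t
  rw [Tally, assignedBelow_succ ht, Finset.card_insert_of_notMem hnot,
    Finset.sum_insert hnot, ← hc, ← ha]
  refine ⟨rfl, add_comm _ _, fun _ => ?_⟩
  rw [Finset.coe_insert, Set.image_insert_eq]
  rcases Nat.eq_zero_or_pos cnt with hz | hp
  · rw [h0 hz]
    rw [hz, eq_comm, Finset.card_eq_zero] at hc
    simp [hc]
  · rw [h1 hp, min_comm]
    exact (hl hp).insert _

theorem ends_tallyProg {x : Fin n} {j : ℕ} (hj : j < m) (hs : Tallying I θ u v f x j s)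
    (h5 : s.nat 5 0 0 = j) :
    Ends tallyProg s 100 fun s' => Tallying I θ u v f x (j + 1) s' ∧ s'.nat 5 0 0 = j := by
  obtain ⟨hr, hw, h6, ht⟩ := hs
  obtain ⟨t, rfl⟩ : ∃ t : Fin m, t.val = j := ⟨⟨j, hj⟩, rfl⟩
  have hgrade := hr.1.grade t x
  have hval := hr.1.val x t
  have hk := hr.1.threshold
  refine (Ends.branch (c := 70) ?_ ?_).mono ?_ fun _ h => h
  · intro htest
    simp only [Test.Holds, curCourse, curTA, nvar, NExpr.eval, h5, h6, hw t] at htest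
    have hf := code_eq_succ_iff.1 (le_antisymm htest.1 htest.2)
    refine (Ends.seq (R := fun s' => ∃ low', s' = s.setDat 6 0 0 low' ∧
        (0 < s.nat 7 0 0 → low' = min (s.dat 6 0 0) (I.grade t x + 1)) ∧
        (s.nat 7 0 0 = 0 → low' = I.grade t x + 1)) (c₁ := 34) ?_ ?_).mono
      (c₁ := 34 + (8 + 28)) (by decide) fun _ h => h
    · refine (Ends.branch (c := 13) ?_ ?_).mono ?_ fun _ h => h
      · intro htest'
        simp only [Test.Holds, curGrade, curCourse, curTA, nvar, dvar, DExpr.eval, NExpr.eval,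
          h5, h6, hgrade, Nat.cast_one] at htest'
        refine (Ends.nop ⟨s.dat 6 0 0, ?_, fun _ => (min_eq_left htest'.2).symm,
          fun h => absurd htest'.1 (by omega)⟩).mono (by decide) fun _ h => h
        -- Keeping the minimum is viewed as overwriting the cell with its own content, so that both
        -- branches end in a memory of the same form.
        cases s
        simp only [Store.setDat, Store.mk.injEq, true_and]
        funext a i j
        split_ifs with h
        · rw [h.1, h.2.1, h.2.2]
        · rfl
      · intro htest'
        simp only [Test.Holds, curGrade, curCourse, curTA, nvar, dvar, DExpr.eval, NExpr.eval,
          h5, h6, hgrade, Nat.cast_one] at htest'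
        refine (Ends.setDat (Q := fun s' => s' = s.setDat 6 0 0 (I.grade t x + 1)) ?_).mono
          (c₂ := 13) ?_ ?_
        · simp [curGrade, curCourse, curTA, nvar, DExpr.eval, NExpr.eval, h5, h6, hgrade]
        · simp [curGrade, curCourse, curTA, nvar, NExpr.cost, DExpr.cost]
        · rintro s' rfl
          exact ⟨_, rfl, fun h => (min_eq_right (not_le.1 fun h' => htest' ⟨h, h'⟩).le).symm,
            fun _ => rfl⟩
      · simp [Test.cost, curGrade, curCourse, curTA, nvar, dvar, NExpr.cost, DExpr.cost]
    · rintro s₁ ⟨low', rfl, h1, h0⟩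
      refine (Ends.seq (Ends.setNat (Q := fun s' =>
          s' = (s.setDat 6 0 0 low').setNat 7 0 0 (s.nat 7 0 0 + 1)) ?_)
        fun s' hs' => Ends.setDat (Q := fun s'' =>
          s'' = ((s.setDat 6 0 0 low').setNat 7 0 0 (s.nat 7 0 0 + 1)).setDat 5 0 0
            (s.dat 5 0 0 + (I.val x t - I.k))) ?_).mono ?_ ?_
      · simp [nvar, NExpr.eval, Store.setDat]
      · subst hs'
        simp [curCourse, curTA, nvar, dvar, NExpr.eval, DExpr.eval, Store.setNat, Store.setDat,
          h5, h6, hval, hk]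
      · simp [curCourse, curTA, nvar, dvar, NExpr.cost, DExpr.cost]
      · rintro s' rfl
        refine ⟨⟨((hr.setDat (by decide)).setNat (by decide) (by decide) (by decide)).setDat
          (by decide), ?_, ?_, ?_⟩, ?_⟩
        · simpa [Writes, Store.setNat, Store.setDat] using hw
        · simpa [Store.setNat, Store.setDat] using h6
        · simpa [Store.setNat, Store.setDat] using ht.succ hf h1 h0
        · simpa [Store.setNat, Store.setDat] using h5
  · intro htest
    simp only [Test.Holds, curCourse, curTA, nvar, NExpr.eval, h5, h6, hw t] at htest
    have hf : f t ≠ some x := fun h => by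
      rw [code_eq_succ_iff.2 h] at htest
      exact htest ⟨le_rfl, le_rfl⟩
    refine (Ends.nop ⟨⟨hr, hw, h6, ?_⟩, h5⟩).mono (by decide) fun _ h => h
    rwa [Tally, assignedBelow_succ_of_ne hf]
  · simp [Test.cost, curCourse, curTA, nvar, NExpr.cost]

/-- The state of the computation after the first `j` courses have rejected. -/
def Raising (I : Instance n m) (θ : Fin n → ℝ) (u v : ℕ) (f : Matching n m) (j : ℕ) (s : Store) :
    Prop :=
  ∃ θ', Ready I θ' u v s ∧ Writes f s ∧
    ∀ x : Fin n, (x.val < j → I.IsRaised f x (θ x) (θ' x)) ∧ (j ≤ x.val → θ' x = θ x)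

theorem ends_rejectProg {x : Fin n} (hs : Tallying I θ' u v f x m s)
    (hθ : ∀ y : Fin n, (y.val < x.val → I.IsRaised f y (θ y) (θ' y)) ∧
      (x.val ≤ y.val → θ' y = θ y)) :
    Ends rejectProg s 40 fun s' => Raising I θ u v f (x + 1) s' ∧ s'.nat 6 0 0 = x := by
  obtain ⟨hr, hw, h6, hc, ha, hl⟩ := hs
  rw [assignedBelow_all] at hc ha hl
  have hcap := hr.1.cap x
  refine (Ends.branch (c := 10) ?_ ?_).mono ?_ fun _ h => h
  · intro htest
    simp only [Test.Holds, curCourse, nvar, dvar, DExpr.eval, NExpr.eval, h6, hcap, hc, ha,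
      Nat.cast_zero] at htest
    -- With the tallied values inserted, the test is `Rejects` by definition.
    have hrej : I.Rejects f x := htest
    refine (Ends.setDat (Q := fun s' => s' = s.setDat 4 x 0 (s.dat 6 0 0)) ?_).mono ?_ ?_
    · simp [curCourse, nvar, dvar, DExpr.eval, NExpr.eval, h6]
    · simp [curCourse, nvar, dvar, DExpr.cost, NExpr.cost]
    · rintro s' rfl
      refine ⟨⟨_, hr.setThreshold x (s.dat 6 0 0), hw, fun y => ⟨fun hy => ?_, fun hy => ?_⟩⟩, h6⟩
      · rcases (Nat.lt_succ_iff_lt_or_eq.1 hy) with hlt | heq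
        · rw [Function.update_of_ne (Fin.ne_of_val_ne hlt.ne)]
          exact (hθ y).1 hlt
        · obtain rfl := Fin.ext heq
          rw [Function.update_self]
          -- The stored minimum is valid because a rejecting course has at least `cap y > 0`
          -- applicants.
          refine ⟨fun _ => hl ?_, fun h => absurd hrej h⟩
          rw [hc]
          exact (I.cap_pos y).trans_le hrej.1
      · rw [Function.update_of_ne (Fin.ne_of_val_ne (by omega))]
        exact (hθ y).2 (by omega)
  · intro htest
    simp only [Test.Holds, curCourse, nvar, dvar, DExpr.eval, NExpr.eval, h6, hcap, hc, ha,
      Nat.cast_zero] at htest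
    have hrej : ¬ I.Rejects f x := htest
    refine (Ends.nop ⟨⟨θ', hr, hw, fun y => ⟨fun hy => ?_, fun hy => (hθ y).2 (by omega)⟩⟩,
      h6⟩).mono (by decide) fun _ h => h
    rcases (Nat.lt_succ_iff_lt_or_eq.1 hy) with hlt | heq
    · exact (hθ y).1 hlt
    · obtain rfl := Fin.ext heq
      exact ⟨fun h => absurd h hrej, fun _ => (hθ y).2 le_rfl⟩
  · simp [Test.cost, curCourse, nvar, dvar, DExpr.cost, NExpr.cost]

theorem Tallying.ignores {x : Fin n} (j : ℕ) : Ignores 5 (Tallying I θ u v f x j) := by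
  rintro s y ⟨hr, hw, h6, ht⟩
  exact ⟨hr.setNat (by decide) (by decide) (by decide), hw.setNat (by decide),
    by simpa [Store.setNat] using h6, by simpa [Store.setNat] using ht⟩

/-- Updating thresholds in place is harmless: rejections depend only on the choices `f`, which stay
fixed during the pass. -/
theorem ends_raiseProg (hs : Ready I θ u v s) (hw : Writes f s) :
    Ends raiseProg s ((n + 1) * (10 + ((m + 1) * (100 + 17) + 40) + 17))
      fun s' => ∃ θ', Ready I θ' u v s' ∧ ∀ x, I.IsRaised f x (θ x) (θ' x) := by
  refine Ends.forLoop (Raising I θ u v f) rfl ?_ ?_ ?_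
    ⟨θ, hs, hw, fun x => ⟨fun h => absurd h (Nat.not_lt_zero _), fun _ => rfl⟩⟩ ?_
  · rintro i s y ⟨θ', hr, hw, h⟩
    exact ⟨θ', hr.setNat (by decide) (by decide) (by decide), hw.setNat (by decide), h⟩
  · rintro i s ⟨θ', hr, -⟩
    exact hr.1.numCourses
  · rintro i s hi ⟨θ', hr, hw, hθ⟩ h6
    refine Ends.seq (R := Tallying I θ' u v f ⟨i, hi⟩ 0) ?_ fun s' hs' =>
      Ends.seq (R := Tallying I θ' u v f ⟨i, hi⟩ m)
        (Ends.forLoop (Tallying I θ' u v f ⟨i, hi⟩) rfl Tallying.ignores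
          (fun j s h => h.1.1.numTAs) (fun j s hj h h5 => ends_tallyProg hj h h5) hs' fun _ h => h)
        fun s'' hs'' => ends_rejectProg hs'' hθ
    refine (Ends.seq (Ends.setNat (Q := fun s' => s' = s.setNat 7 0 0 0) ?_)
      fun s' hs' => Ends.setDat (Q := fun s'' =>
        s'' = (s.setNat 7 0 0 0).setDat 5 0 0 0) ?_).mono ?_ ?_
    · simp [NExpr.eval]
    · simp [DExpr.eval, NExpr.eval, hs']
    · simp [NExpr.cost, DExpr.cost]
    · rintro s' rfl
      refine ⟨(hr.setNat (by decide) (by decide) (by decide)).setDat (by decide),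
        ?_, ?_, ?_⟩
      · simpa [Writes, Store.setNat, Store.setDat] using hw
      · simp [Store.setNat, Store.setDat, h6]
      · simp [Store.setNat, Store.setDat, Tally, assignedBelow_zero]
  · rintro s' ⟨θ', hr, -, hθ⟩
    exact ⟨θ', hr, fun x => (hθ x).1 x.isLt⟩

/-! ### The whole program -/

/-- Time for a round. -/
def roundCost (n m : ℕ) : ℕ :=
  (m + 1) * (11 + (n + 1) * (60 + 17) + 17) + (n + 1) * (10 + ((m + 1) * (100 + 17) + 40) + 17)

theorem ends_round (hu : I.DistinctUtils) {r : ℕ} (hs : Ready I θ u v s) (hθ : I.Reached r θ) :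
    Ends (.seq chooseProg raiseProg) s (roundCost n m)
      fun s' => ∃ θ', Ready I θ' u v s' ∧ I.Reached (r + 1) θ' := by
  refine Ends.seq (ends_chooseProg hs) ?_
  rintro s₁ ⟨hr, f, hw, hf⟩
  refine (ends_raiseProg hr hw).mono le_rfl ?_
  rintro s₂ ⟨θ', hr', hraise⟩
  exact ⟨θ', hr', hθ.raise hu hf hraise⟩

/-- The state of the computation after `r` rounds. -/
def AfterRounds (I : Instance n m) (r : ℕ) (s : Store) : Prop :=
  ∃ θ, Stored I θ s ∧ I.Reached r θ

theorem AfterRounds.ignores {a : ℕ} (ha : 1 < a) (r : ℕ) : Ignores a (AfterRounds I r) := by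
  rintro s y ⟨θ, hs, h⟩
  exact ⟨θ, hs.setNat ha, h⟩

/-- The machine cannot multiply, so `m * n` rounds are run as a double loop whose state (i, j)
stands for `i * n + j` rounds. A last pass writes the choices for the settled thresholds. -/
theorem ends_matchProg (hu : I.DistinctUtils) (hs : Stored I (fun _ => 0) s) :
    Ends matchProg s
      ((m + 1) * ((n + 1) * (roundCost n m + 17) + 17) +
        (m + 1) * (11 + (n + 1) * (60 + 17) + 17))
      fun s' => I.IsYes → I.FairAt (I.k : ℝ) (decode n m s') := by
  refine Ends.seq (R := AfterRounds I (m * n)) ?_ ?_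
  · have hzero : AfterRounds I (0 * n) s := by
      rw [Nat.zero_mul]
      exact ⟨_, hs, reached_zero⟩
    refine Ends.forLoop (fun i => AfterRounds I (i * n)) rfl
      (fun i => AfterRounds.ignores (by decide) _) ?_ ?_ hzero fun _ h => h
    · rintro i s ⟨θ, hs, -⟩
      exact hs.numTAs
    · intro i s _ hs h3
      have hstart : AfterRounds I (i * n + 0) s ∧ s.nat 3 0 0 = i := ⟨hs, h3⟩
      refine Ends.forLoop (fun j s' => AfterRounds I (i * n + j) s' ∧ s'.nat 3 0 0 = i) rfl
        ?_ ?_ ?_ hstart ?_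
      · rintro j s y ⟨h, h3⟩
        exact ⟨AfterRounds.ignores (by decide) _ s y h, by simpa [Store.setNat] using h3⟩
      · rintro j s ⟨⟨θ, hs, -⟩, -⟩
        exact hs.numCourses
      · rintro j s _ ⟨⟨θ, hs, hθ⟩, h3⟩ h4
        have hr : Ready I θ i j s := ⟨hs, h3, h4⟩
        refine (ends_round hu hr hθ).mono le_rfl ?_
        rintro s' ⟨θ', hr, hθ'⟩
        exact ⟨⟨⟨θ', hr.1, hθ'⟩, hr.2.1⟩, hr.2.2⟩
      · rintro s' ⟨h, h3⟩
        rw [Nat.add_mul, Nat.one_mul]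
        exact ⟨h, h3⟩
  · rintro s₁ ⟨θ, hs, hθ⟩
    have hr : Ready I θ (s₁.nat 3 0 0) (s₁.nat 4 0 0) s₁ := ⟨hs, rfl, rfl⟩
    refine (ends_chooseProg hr).mono le_rfl ?_
    intro s₂ h hyes
    obtain ⟨-, f, hw, hf⟩ := h
    rw [hw.decode_eq]
    exact hθ.settled.fairAt hθ.1 hf hyes

/-- Four nested loops, two counting rounds and two within a round, give degree four. Written in `b`,
the comparison holds coefficient by coefficient. -/
theorem matchProg_cost_le (n m : ℕ) :
    (m + 1) * ((n + 1) * (roundCost n m + 17) + 17) + (m + 1) * (11 + (n + 1) * (60 + 17) + 17) ≤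
      1000 * (n + m + 1) ^ 4 := by
  have hn : n + 1 ≤ n + m + 1 := by omega
  have hm : m + 1 ≤ n + m + 1 := by omega
  generalize hB : n + m + 1 = B at hn hm
  obtain ⟨b, rfl⟩ : ∃ b, B = b + 1 := ⟨n + m, hB.symm⟩
  have hround : roundCost n m ≤ (b + 1) * (11 + (b + 1) * (60 + 17) + 17) +
      (b + 1) * (10 + ((b + 1) * (100 + 17) + 40) + 17) := by
    unfold roundCost
    gcongr
  calc _ ≤ (b + 1) * ((b + 1) * ((b + 1) * (11 + (b + 1) * (60 + 17) + 17) +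
      (b + 1) * (10 + ((b + 1) * (100 + 17) + 40) + 17) + 17) + 17) +
        (b + 1) * (11 + (b + 1) * (60 + 17) + 17) := by gcongr
    _ ≤ _ := by
      ring_nf
      have := Nat.zero_le (b ^ 2)
      have := Nat.zero_le (b ^ 3)
      have := Nat.zero_le (b ^ 4)
      linarith

/-- The exponential factor of the time bound is at least one. -/
theorem one_le_maxCap_rpow (I : Instance n m) {ε : ℝ} (h0 : 0 < ε) (h1 : ε < 1) :
    1 ≤ (I.maxCap : ℝ) ^
      ((n : ℝ) * Real.log (I.maxVal : ℝ) / Real.log (1 + (1 / (1 - ε) - 1))) := by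
  rcases Nat.eq_zero_or_pos n with rfl | hn
  -- Without courses `maxCap` is 0, but the exponent is 0 as well and the power is 1.
  · simp
  · have hle : I.cap ⟨0, hn⟩ ≤ I.maxCap := Finset.le_sup (f := I.cap) (Finset.mem_univ _)
    have hcap : (1 : ℝ) ≤ I.maxCap := by exact_mod_cast (I.cap_pos _).trans_le hle
    refine Real.one_le_rpow hcap (div_nonneg
      (mul_nonneg n.cast_nonneg (Real.log_natCast_nonneg _)) (Real.log_nonneg ?_))
    have : 1 ≤ 1 / (1 - ε) := (one_le_div (by linarith)).2 (by linarith)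
    linarith

end MEFE

theorem theorem11 :
    ∃ (P : MEFE.Prog) (d : ℕ), ∀ C : ℕ, ∃ A : ℝ,
      ∀ (n m : ℕ) (I : MEFE.Instance n m) (ε : ℝ),
        0 ≤ ε → ε < 1 →
        (∀ x, I.cap x ≤ C) → I.DistinctGrades → I.DistinctUtils →
        ∃ (N : ℕ) (s : MEFE.Store), MEFE.Runs P (MEFE.encode I ε) N s ∧
          (0 < ε →
            (N : ℝ) ≤ A *
              (I.maxCap : ℝ) ^
                ((n : ℝ) * Real.log (I.maxVal : ℝ) / Real.log (1 + (1 / (1 - ε) - 1))) *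
              ((n : ℝ) + (m : ℝ) + 1) ^ d) ∧
          (I.IsYes → I.FairAt ((1 - ε) * (I.k : ℝ)) (MEFE.decode n m s)) := by
  refine ⟨MEFE.matchProg, 4, fun _ => ⟨1000, fun n m I ε h0 h1 _ _ hu => ?_⟩⟩
  obtain ⟨N, s, hrun, hN, hfair⟩ := MEFE.ends_matchProg hu (MEFE.stored_encode I ε)
  refine ⟨N, s, hrun, fun hε => ?_, fun hyes => (hfair hyes).mono ?_⟩
  · have hN' : (N : ℝ) ≤ 1000 * ((n : ℝ) + m + 1) ^ 4 := by
      exact_mod_cast hN.trans (MEFE.matchProg_cost_le n m)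
    refine hN'.trans (mul_le_mul_of_nonneg_right ?_ (by positivity))
    exact le_mul_of_one_le_right (by norm_num) (MEFE.one_le_maxCap_rpow I hε h1)
  -- The matching reaches `k` itself, and `(1 - ε) * k ≤ k`.
  · have hk : (0 : ℝ) ≤ I.k := by positivity
    exact mul_le_of_le_one_left hk (by linarith)
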